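/- Let $G$ be a second countable locally compact Hausdorff topological groupoid with unit space $G^0$, range map $r$ and domain map $d$. A continuous Hilbert bundle over $G^0$ is a continuous field $\mathcal H=\{\mathcal H_u\}_{u\in G^0}$ of separable complex Hilbert spaces with its space $\Gamma$ of continuous sections: $\Gamma$ is a linear subspace of $\prod_u\mathcal H_u$, fibrewise dense, $u\mapsto\|\xi(u)\|$ is continuous for each $\xi\in\Gamma$, and every vector field that near each point can be approximated uniformly by elements of $\Gamma$ lies in $\Gamma$. The sections in $\Gamma$ whose norm vanishes at infinity form the Hilbert $C_0(G^0)$-module $C_0(G^0,\mathcal H)$. A continuous unitary representation $(\mathcal H^\pi,\pi)$ of $G$ consists of such a bundle $\mathcal H^\pi$ and unitaries $\pi(x):\mathcal H^\pi_{d(x)}\to\mathcal H^\pi_{r(x)}$ $(x\in G)$ with $\pi(u)=\mathrm{id}$ for $u\in G^0$, $\pi(xy)=\pi(x)\pi(y)$ for composable $x,y$, $\pi(x^{-1})=\pi(x)^{-1}$, and $x\mapsto\langle\pi(x)\xi(d(x)),\eta(r(x))\rangle$ continuous for all $\xi,\eta\in C_0(G^0,\mathcal H^\pi)$. An adjointable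 operator $T$ on $C_0(G^0,\mathcal H^\pi)$ induces bounded operators $T_u$ on the fibres by $T_u\xi(u)=(T\xi)(u)$; $T$ is Hilbert–Schmidt if $u\mapsto\operatorname{tr}|T_u|^2$ belongs to $C_0(G^0)$, and then $\|T\|_2=\sup_u\|T_u\|_2$, where $\|T_u\|_2=(\operatorname{tr}|T_u|^2)^{1/2}$. The representation $\pi$ is amenable if there is a net $\{T^i\}_{i\in I}$ of Hilbert–Schmidt operators on $C_0(G^0,\mathcal H^\pi)$ with $\|T^i\|_2\le1$ such that $\|T^i_u\|_2\to1$ uniformly on compact subsets of $G^0$ and, with $\langle A,B\rangle=\operatorname{tr}(B^*A)$, $$\big\langle \pi(x)T^i_{d(x)}\pi(x^{-1}),\,T^i_{r(x)}\big\rangle\to1$$ uniformly on compact subsets of $G$. Let $\pi$ be a continuous unitary representation of $G$ such that $C_0(G^0,\mathcal H^\pi)$ is countably generated as a Hilbert $C_0(G^0)$-module. Let $\rho$ be a subrepresentation of $\pi$: a continuous unitary representation whose fibres $\mathcal H^\rho_u$ are closed subspaces of $\mathcal H^\pi_u$, whose continuous sections are continuous sections of $\mathcal H^\pi$, and for which $\rho(x)$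 is the restriction of $\pi(x)$ for every $x\in G$. Suppose that $C_0(G^0,\mathcal H^\rho)$ is a complemented submodule of $C_0(G^0,\mathcal H^\pi)$, i.e. $C_0(G^0,\mathcal H^\pi)=C_0(G^0,\mathcal H^\rho)\oplus C_0(G^0,\mathcal H^\rho)^{\perp}$. If $\rho$ is amenable, then $\pi$ is amenable. -/

import Mathlib

universe u v w

namespace GroupoidRep

open CategoryTheory Filter Topology
open scoped ZeroAtInfty ENNReal NNReal

-- so that `inner ℂ` is read as the inner product of the Hilbert space
attribute [-instance] WithCStarModule.instCStarModuleComplex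

/-! ### Topological groupoids

A groupoid is a small category all of whose morphisms are invertible.  Its set of objects `X` is the
unit space, and `Arrows X` is the groupoid as the set of all its arrows.  An arrow `x : s ⟶ t` has
domain `s` and range `t`; the groupoid product `x y` (defined when the domain of `x` is the range of
`y`) is the composite "first `y`, then `x`", that is `y ≫ x` in categorical notation. -/

/-- The set of all arrows of a groupoid with unit space `X`. -/
structure Arrows (X : Type u) [Groupoid.{v} X] where
  /-- the domain of the arrow -/
  dom : X
  /-- the range of the arrow -/
  rng : X
  /-- the arrow itself -/
  hom : dom ⟶ rng

namespace Arrows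

variable {X : Type u} [Groupoid.{v} X]

/-- The unit arrow at a point of the unit space. -/
def unit (s : X) : Arrows X := ⟨s, s, 𝟙 s⟩

/-- The inverse of an arrow. -/
def inv (x : Arrows X) : Arrows X := ⟨x.rng, x.dom, Groupoid.inv x.hom⟩

/-- The product `x y` of a composable pair: the domain of `x` is the range of `y`. -/
def mul (p : {p : Arrows X × Arrows X // p.1.dom = p.2.rng}) : Arrows X :=
  ⟨p.1.2.dom, p.1.1.rng, p.1.2.hom ≫ eqToHom p.2.symm ≫ p.1.1.hom⟩

end Arrows

/-- A topological groupoid: inversion is continuous, the product is continuous on the set of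
composable pairs (with the topology induced from the product), and the unit space carries the
topology induced from the space of arrows. -/
class TopologicalGroupoid (X : Type u) [Groupoid.{v} X] [TopologicalSpace X]
    [TopologicalSpace (Arrows X)] : Prop where
  continuous_inv : Continuous (Arrows.inv : Arrows X → Arrows X)
  continuous_mul : Continuous (Arrows.mul : _ → Arrows X)
  isEmbedding_unit : IsEmbedding (Arrows.unit : X → Arrows X)

section UnitSpace

variable (X : Type u) [Groupoid.{v} X] [TopologicalSpace X] [TopologicalSpace (Arrows X)]
  [TopologicalGroupoid X]

theorem continuous_unit_dom : Continuous fun x : Arrows X => Arrows.unit x.dom := by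
  have h : Continuous fun x : Arrows X =>
      (⟨(x.inv, x), rfl⟩ : {p : Arrows X × Arrows X // p.1.dom = p.2.rng}) :=
    (TopologicalGroupoid.continuous_inv.prodMk continuous_id).subtype_mk _
  have h2 := (TopologicalGroupoid.continuous_mul (X := X)).comp h
  convert h2 using 2 with x
  simp [Arrows.mul, Arrows.inv, Arrows.unit]

instance t2Space_unitSpace [T2Space (Arrows X)] : T2Space X :=
  (TopologicalGroupoid.isEmbedding_unit (X := X)).t2Space

/-- The unit space of a Hausdorff groupoid is closed, hence inherits local compactness. -/
instance locallyCompactSpace_unitSpace [T2Space (Arrows X)] [LocallyCompactSpace (Arrows X)] :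
    LocallyCompactSpace X := by
  have hc : IsClosed (Set.range (Arrows.unit : X → Arrows X)) := by
    have : Set.range (Arrows.unit : X → Arrows X) = {x | Arrows.unit x.dom = x} := by
      ext x
      constructor
      · rintro ⟨s, rfl⟩; rfl
      · intro h; exact ⟨x.dom, h⟩
    rw [this]
    exact isClosed_eq (continuous_unit_dom X) continuous_id
  exact (IsClosedEmbedding.mk
    (TopologicalGroupoid.isEmbedding_unit (X := X)) hc).locallyCompactSpace

end UnitSpace

/-! ### Continuous fields of Hilbert spaces and their sections vanishing at infinity -/

/-- A continuous field of separable Hilbert spaces over `X` (equivalently, a continuous Hilbert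
bundle), given by its space of continuous sections. -/
structure HilbertField (X : Type u) [TopologicalSpace X] (H : X → Type w)
    [∀ s, NormedAddCommGroup (H s)] [∀ s, InnerProductSpace ℂ (H s)]
    [∀ s, CompleteSpace (H s)] where
  /-- the space of continuous sections -/
  sections : Submodule ℂ (∀ s, H s)
  separable : ∀ s, TopologicalSpace.SeparableSpace (H s)
  dense : ∀ s, Dense {h : H s | ∃ ξ ∈ sections, ξ s = h}
  continuous_norm : ∀ ξ ∈ sections, Continuous fun s => ‖ξ s‖
  local_approx : ∀ ξ : (∀ s, H s),
    (∀ s, ∀ ε > 0, ∃ ξ' ∈ sections, ∀ᶠ t in 𝓝 s, ‖ξ t - ξ' t‖ < ε) → ξ ∈ sections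

namespace HilbertField

variable {X : Type u} [TopologicalSpace X] {H : X → Type w}
  [∀ s, NormedAddCommGroup (H s)] [∀ s, InnerProductSpace ℂ (H s)] [∀ s, CompleteSpace (H s)]

/-- The space `C₀(X, H)` of continuous sections whose norm vanishes at infinity. -/
def c0 (F : HilbertField X H) : Submodule ℂ (∀ s, H s) where
  carrier := {ξ | ξ ∈ F.sections ∧ Tendsto (fun s => ‖ξ s‖) (cocompact X) (𝓝 0)}
  zero_mem' := ⟨F.sections.zero_mem, by simpa using tendsto_const_nhds⟩
  add_mem' := by
    rintro ξ η ⟨h1, h2⟩ ⟨h3, h4⟩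
    refine ⟨F.sections.add_mem h1 h3, ?_⟩
    have := h2.add h4
    rw [add_zero] at this
    exact squeeze_zero (fun s => norm_nonneg _) (fun s => norm_add_le _ _) this
  smul_mem' := by
    rintro c ξ ⟨h1, h2⟩
    refine ⟨F.sections.smul_mem c h1, ?_⟩
    have := h2.const_mul ‖c‖
    rw [mul_zero] at this
    simpa [norm_smul] using this

variable (F : HilbertField X H)

theorem continuous_inner {ξ η : ∀ s, H s} (hξ : ξ ∈ F.sections) (hη : η ∈ F.sections) :
    Continuous fun s => inner ℂ (ξ s) (η s) := by
  have h (c : ℂ) : Continuous fun s => ‖ξ s + c • η s‖ :=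
    F.continuous_norm _ (F.sections.add_mem hξ (F.sections.smul_mem c hη))
  have h1 := h 1
  have h2 := h (-1)
  have h3 := h Complex.I
  have h4 := h (-Complex.I)
  simp only [one_smul, neg_smul, ← sub_eq_add_neg] at h1 h2 h3 h4
  simp only [inner_eq_sum_norm_sq_div_four, RCLike.I_to_complex]
  fun_prop

/-- The `C₀(X)`-valued inner product of two sections, linear in the first variable. -/
noncomputable def c0Inner (ξ η : F.c0) : C₀(X, ℂ) where
  toFun s := inner ℂ (η.1 s) (ξ.1 s)
  continuous_toFun := F.continuous_inner η.2.1 ξ.2.1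
  zero_at_infty' := by
    have := η.2.2.mul ξ.2.2
    rw [mul_zero] at this
    exact squeeze_zero_norm (fun s => norm_inner_le_norm _ _) this

@[simp]
theorem c0Inner_apply (ξ η : F.c0) (s : X) : F.c0Inner ξ η s = inner ℂ (η.1 s) (ξ.1 s) := rfl

theorem smul_mem_sections {f : X → ℂ} (hf : Continuous f) {ξ : ∀ s, H s}
    (hξ : ξ ∈ F.sections) : (fun s => f s • ξ s) ∈ F.sections := by
  refine F.local_approx _ fun s ε hε => ⟨f s • ξ, F.sections.smul_mem _ hξ, ?_⟩
  have hc : Continuous fun t => ‖f t - f s‖ * ‖ξ t‖ :=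
    (hf.sub continuous_const).norm.mul (F.continuous_norm ξ hξ)
  have := hc.tendsto s
  simp only [sub_self, norm_zero, zero_mul] at this
  filter_upwards [this.eventually_lt_const hε] with t ht
  rwa [Pi.smul_apply, ← sub_smul, norm_smul]

/-- The module action of `C₀(X)` on `C₀(X, H)`. -/
noncomputable def c0Smul (f : C₀(X, ℂ)) (ξ : F.c0) : F.c0 :=
  ⟨fun s => f s • ξ.1 s, F.smul_mem_sections f.continuous ξ.2.1, by
    have := (tendsto_zero_iff_norm_tendsto_zero.mp f.zero_at_infty').mul ξ.2.2
    rw [mul_zero] at this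
    refine this.congr fun s => ?_
    exact (norm_smul _ _).symm⟩

/-- `C₀(X, H)` is countably generated as a Hilbert `C₀(X)`-module: the `C₀(X)`-linear combinations
of some countable set of sections are dense in the supremum norm. -/
def CountablyGenerated : Prop :=
  ∃ S : Set F.c0, S.Countable ∧ ∀ ξ : F.c0, ∀ ε > 0,
    ∃ η ∈ Submodule.span ℂ {ζ : F.c0 | ∃ f : C₀(X, ℂ), ∃ σ ∈ S, ζ = F.c0Smul f σ},
      ∀ s, ‖ξ.1 s - η.1 s‖ ≤ ε

/-! #### Every vector of a fibre is the value of a section vanishing at infinity -/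

variable {F}

section Surjective

variable [T2Space X] [LocallyCompactSpace X]

theorem exists_c0_approx (s : X) (g : H s) {c : ℝ} (hc : 0 < c) (hg : ‖g‖ ≤ c) :
    ∃ ξ ∈ F.c0, (∀ t, ‖ξ t‖ ≤ 2 * c) ∧ ‖g - ξ s‖ ≤ c / 2 := by
  obtain ⟨h, hlt, ⟨ξ, hξ, rfl⟩⟩ := Metric.dense_iff.mp (F.dense s) g (c / 2) (by positivity)
  have hd : ‖g - ξ s‖ ≤ c / 2 := by
    rw [Metric.mem_ball, dist_comm, dist_eq_norm] at hlt
    exact hlt.le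
  have hb : ‖ξ s‖ ≤ 2 * c := by
    have : ‖ξ s‖ ≤ ‖g‖ + ‖g - ξ s‖ := by
      have := norm_sub_le g (g - ξ s)
      simpa using this
    linarith
  obtain ⟨φ, h1, -, hcs, h01⟩ := exists_continuous_one_zero_of_isCompact
    (isCompact_singleton (x := s)) isClosed_empty (Set.disjoint_empty _)
  set k : X → ℝ := fun t => φ t * (2 * c / max (2 * c) ‖ξ t‖) with hk
  have hpos : ∀ t, 0 < max (2 * c) ‖ξ t‖ := fun t => lt_max_of_lt_left (by positivity)
  have hkc : Continuous k := by
    refine φ.continuous.mul (continuous_const.div ?_ fun t => (hpos t).ne')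
    exact continuous_const.max (F.continuous_norm ξ hξ)
  have hks : k s = 1 := by
    have : φ s = 1 := h1 rfl
    rw [hk]
    simp only [this, max_eq_left hb, one_mul]
    exact div_self (by positivity)
  have hkn : ∀ t, ‖((k t : ℝ) : ℂ) • ξ t‖ ≤ 2 * c := by
    intro t
    have hq : 0 ≤ 2 * c / max (2 * c) ‖ξ t‖ := by have := hpos t; positivity
    rw [norm_smul, Complex.norm_real, Real.norm_of_nonneg (mul_nonneg (h01 t).1 hq)]
    calc φ t * (2 * c / max (2 * c) ‖ξ t‖) * ‖ξ t‖
        ≤ 1 * (2 * c / max (2 * c) ‖ξ t‖) * max (2 * c) ‖ξ t‖ := by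
          gcongr
          · exact (h01 t).2
          · exact le_max_right _ _
      _ = 2 * c := by rw [one_mul, div_mul_cancel₀ _ (hpos t).ne']
  refine ⟨fun t => ((k t : ℝ) : ℂ) • ξ t,
    ⟨F.smul_mem_sections (Complex.continuous_ofReal.comp hkc) hξ, ?_⟩, hkn, ?_⟩
  · refine tendsto_const_nhds.congr' ?_
    filter_upwards [hcs.isCompact.compl_mem_cocompact] with t ht
    have : φ t = 0 := image_eq_zero_of_notMem_tsupport ht
    simp [hk, this]
  · simpa [hks] using hd

theorem exists_c0_eq (s : X) (g : H s) : ∃ ξ : F.c0, ξ.1 s = g := by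
  obtain ⟨c, hc, hgc⟩ : ∃ c : ℝ, 0 < c ∧ ‖g‖ ≤ c := ⟨‖g‖ + 1, by positivity, by linarith⟩
  have key : ∀ (n : ℕ) (r : {r : H s // ‖r‖ ≤ c / 2 ^ n}), ∃ ξ ∈ F.c0,
      (∀ t, ‖ξ t‖ ≤ 2 * (c / 2 ^ n)) ∧ ‖r.1 - ξ s‖ ≤ c / 2 ^ (n + 1) := by
    intro n r
    obtain ⟨ξ, h1, h2, h3⟩ := exists_c0_approx (F := F) s r.1 (c := c / 2 ^ n) (by positivity) r.2
    refine ⟨ξ, h1, h2, h3.trans_eq ?_⟩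
    rw [pow_succ, div_div]
  choose A hA0 hAb hAr using key
  let r : ∀ n : ℕ, {r : H s // ‖r‖ ≤ c / 2 ^ n} := fun n => Nat.rec
    ⟨g, by simpa using hgc⟩ (fun n r => ⟨r.1 - A n r s, hAr n r⟩) n
  let a : ℕ → ∀ t, H t := fun n => A n (r n)
  have hr : ∀ n, (r (n + 1)).1 = (r n).1 - a n s := fun n => rfl
  have hsum : ∀ n, ∑ i ∈ Finset.range n, a i s = g - (r n).1 := by
    intro n
    induction n with
    | zero => simp [r]
    | succ n ih => rw [Finset.sum_range_succ, ih, hr]; abel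
  have hbd : ∀ n t, ‖a n t‖ ≤ (4 * c) / 2 / 2 ^ n := fun n t => by
    refine (hAb n (r n) t).trans_eq ?_
    ring
  have hsu : ∀ t, Summable fun n => a n t := fun t =>
    Summable.of_norm_bounded (summable_geometric_two' (4 * c)) (hbd · t)
  let ξ : ∀ t, H t := fun t => ∑' n, a n t
  have htail : ∀ n t, ‖ξ t - ∑ i ∈ Finset.range n, a i t‖ ≤ 4 * c / 2 ^ n := by
    intro n t
    have h := dist_le_of_le_geometric_two_of_tendsto (f := fun n => ∑ i ∈ Finset.range n, a i t)
      (C := 4 * c) (a := ξ t) (fun m => ?_) (hsu t).hasSum.tendsto_sum_nat n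
    · rwa [dist_comm, dist_eq_norm] at h
    · rw [dist_comm, dist_eq_norm, Finset.sum_range_succ, add_sub_cancel_left]
      exact hbd m t
  have hsmall : ∀ ε > 0, ∃ n : ℕ, 4 * c / 2 ^ n < ε := by
    intro ε hε
    obtain ⟨n, hn⟩ := exists_pow_lt_of_lt_one (show 0 < ε / (4 * c) by positivity)
      (show (1 / 2 : ℝ) < 1 by norm_num)
    refine ⟨n, ?_⟩
    rw [lt_div_iff₀ (by positivity)] at hn
    calc 4 * c / 2 ^ n = (1 / 2) ^ n * (4 * c) := by rw [one_div, inv_pow]; field_simp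
      _ < ε := hn
  have hpart : ∀ n, (∑ i ∈ Finset.range n, a i) ∈ F.c0 := fun n =>
    F.c0.sum_mem fun i _ => hA0 i (r i)
  refine ⟨⟨ξ, F.local_approx ξ fun t ε hε => ?_, ?_⟩, ?_⟩
  · obtain ⟨n, hn⟩ := hsmall ε hε
    refine ⟨_, (hpart n).1, Eventually.of_forall fun t => ?_⟩
    rw [Finset.sum_apply]
    exact (htail n t).trans_lt hn
  · rw [Metric.tendsto_nhds]
    intro ε hε
    obtain ⟨n, hn⟩ := hsmall (ε / 2) (by positivity)
    filter_upwards [(hpart n).2.eventually_lt_const (show 0 < ε / 2 by positivity)] with t ht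
    rw [Finset.sum_apply] at ht
    rw [dist_zero_right, norm_norm]
    have h1 := htail n t
    have h2 := norm_add_le (ξ t - ∑ i ∈ Finset.range n, a i t) (∑ i ∈ Finset.range n, a i t)
    rw [sub_add_cancel] at h2
    linarith
  · refine tendsto_nhds_unique (hsu s).hasSum.tendsto_sum_nat ?_
    rw [tendsto_iff_norm_sub_tendsto_zero]
    have h0 : Tendsto (fun n : ℕ => c / 2 ^ n) atTop (𝓝 0) := by
      have := (tendsto_pow_atTop_nhds_zero_of_lt_one (show (0 : ℝ) ≤ 1 / 2 by norm_num)
        (by norm_num)).const_mul c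
      rw [mul_zero] at this
      refine this.congr fun n => ?_
      rw [one_div, inv_pow]; rfl
    refine squeeze_zero (fun n => norm_nonneg _) (fun n => ?_) h0
    rw [hsum]
    simpa using (r n).2

end Surjective

variable (F)

/-- An adjointable operator on the Hilbert `C₀(X)`-module `C₀(X, H)`: a map that has an adjoint for
the `C₀(X)`-valued inner product.  Linearity, `C₀(X)`-linearity and boundedness are automatic. -/
structure Adjointable where
  /-- the underlying map -/
  toFun : F.c0 → F.c0
  exists_adjoint : ∃ S : F.c0 → F.c0, ∀ ξ η, F.c0Inner (toFun ξ) η = F.c0Inner ξ (S η)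

/-- The orthogonal complement, in the Hilbert module `C₀(X, H)`, of a set of sections. -/
def orthogonal (E : Submodule ℂ (∀ s, H s)) : Submodule ℂ (∀ s, H s) where
  carrier := {η | η ∈ F.c0 ∧ ∀ ζ ∈ E, ∀ s, inner ℂ (ζ s) (η s) = 0}
  zero_mem' := ⟨F.c0.zero_mem, by simp⟩
  add_mem' := by
    rintro ξ η ⟨h1, h2⟩ ⟨h3, h4⟩
    exact ⟨F.c0.add_mem h1 h3, fun ζ hζ s => by
      rw [Pi.add_apply, inner_add_right, h2 ζ hζ s, h4 ζ hζ s, add_zero]⟩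
  smul_mem' := by
    rintro c ξ ⟨h1, h2⟩
    exact ⟨F.c0.smul_mem c h1, fun ζ hζ s => by
    rw [Pi.smul_apply, inner_smul_right, h2 ζ hζ s, mul_zero]⟩

/-- `E` is a complemented submodule of the Hilbert module `C₀(X, H)`, that is
`C₀(X, H) = E ⊕ E^⊥`. -/
def IsComplemented (E : Submodule ℂ (∀ s, H s)) : Prop :=
  E ≤ F.c0 ∧ E ⊔ F.orthogonal E = F.c0

variable {F}

namespace Adjointable

variable (T : F.Adjointable)

theorem exists_adjoint_apply : ∃ S : F.c0 → F.c0, ∀ ξ η s,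
    inner ℂ (η.1 s) ((T.toFun ξ).1 s) = inner ℂ ((S η).1 s) (ξ.1 s) := by
  obtain ⟨S, hS⟩ := T.exists_adjoint
  exact ⟨S, fun ξ η s => DFunLike.congr_fun (hS ξ η) s⟩

variable [T2Space X] [LocallyCompactSpace X]

/-- The operator on a fibre induced by an adjointable operator exists and is bounded. -/
theorem exists_localization (s : X) :
    ∃ A : H s →L[ℂ] H s, ∀ ξ : F.c0, A (ξ.1 s) = (T.toFun ξ).1 s := by
  obtain ⟨S, hS⟩ := T.exists_adjoint_apply
  choose σ hσ using fun h : H s => exists_c0_eq (F := F) s h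
  have hadj : ∀ (ξ : F.c0) (h : H s),
      inner ℂ h ((T.toFun ξ).1 s) = inner ℂ ((S (σ h)).1 s) (ξ.1 s) := fun ξ h => by
    rw [← hS, hσ]
  let L : H s →ₗ[ℂ] H s :=
    { toFun := fun h => (T.toFun (σ h)).1 s
      map_add' := fun a b => ext_inner_left ℂ fun h => by
        simp only [inner_add_right, hadj, hσ]
      map_smul' := fun c a => ext_inner_left ℂ fun h => by
        simp only [inner_smul_right, hadj, hσ, RingHom.id_apply] }
  have hL : ∀ h k, inner ℂ k (L h) = inner ℂ ((S (σ k)).1 s) h := fun h k => by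
    change inner ℂ k ((T.toFun (σ h)).1 s) = _
    rw [hadj, hσ]
  refine ⟨ContinuousLinearMap.ofSeqClosedGraph (g := L) fun a x y hx hy => ?_, fun ξ => ?_⟩
  · refine ext_inner_left ℂ fun k => ?_
    refine tendsto_nhds_unique ((tendsto_const_nhds (x := k)).inner hy) ?_
    simp only [Function.comp_apply, hL]
    exact tendsto_const_nhds.inner hx
  · refine ext_inner_left ℂ fun k => ?_
    rw [ContinuousLinearMap.coeFn_ofSeqClosedGraph, hL, hadj]

/-- The localization `T_s` of `T` at `s`: the bounded operator on the fibre `H s` that sends `ξ(s)`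
to `(T ξ)(s)`. -/
noncomputable def localization (s : X) : H s →L[ℂ] H s := (T.exists_localization s).choose

theorem localization_apply (s : X) (ξ : F.c0) :
    T.localization s (ξ.1 s) = (T.toFun ξ).1 s := (T.exists_localization s).choose_spec ξ

end Adjointable

end HilbertField

/-! ### Hilbert–Schmidt operators -/

section HilbertSchmidt

variable {K : Type w} [NormedAddCommGroup K] [InnerProductSpace ℂ K] [CompleteSpace K]

variable (K) in
/-- The index set of a chosen orthonormal basis of a Hilbert space. -/
def basisIndex : Set K := (exists_hilbertBasis ℂ K).choose

variable (K) in
/-- A chosen orthonormal basis of a Hilbert space. -/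
noncomputable def basis : HilbertBasis (basisIndex K) ℂ K :=
  (exists_hilbertBasis ℂ K).choose_spec.choose

/-- The trace of `|A|²` for a bounded operator `A` on a Hilbert space, possibly infinite. -/
noncomputable def traceSq (A : K →L[ℂ] K) : ℝ≥0∞ := ∑' i, ‖A (basis K i)‖ₑ ^ 2

/-- The Hilbert–Schmidt norm of a bounded operator on a Hilbert space, possibly infinite. -/
noncomputable def hsNorm (A : K →L[ℂ] K) : ℝ≥0∞ := traceSq A ^ (1 / 2 : ℝ)

/-- The inner product `⟨A, B⟩ = tr(B* A)` of two Hilbert–Schmidt operators on a Hilbert space. -/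
noncomputable def hsInner (A B : K →L[ℂ] K) : ℂ := ∑' i, inner ℂ (B (basis K i)) (A (basis K i))

end HilbertSchmidt

namespace HilbertField.Adjointable

variable {X : Type u} [TopologicalSpace X] [T2Space X] [LocallyCompactSpace X] {H : X → Type w}
  [∀ s, NormedAddCommGroup (H s)] [∀ s, InnerProductSpace ℂ (H s)] [∀ s, CompleteSpace (H s)]
  {F : HilbertField X H}

/-- `T` is a Hilbert–Schmidt operator on the Hilbert module `C₀(X, H)`: the function
`s ↦ tr |T_s|²` is (finite-valued and) an element of `C₀(X)`. -/
def IsHilbertSchmidt (T : F.Adjointable) : Prop :=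
  ∃ f : C₀(X, ℝ≥0), ∀ s, traceSq (T.localization s) = f s

/-- The norm `‖T‖₂` of the Hilbert module of Hilbert–Schmidt operators: the supremum of the fibrewise
Hilbert–Schmidt norms. -/
noncomputable def hsModuleNorm (T : F.Adjointable) : ℝ≥0∞ := ⨆ s, hsNorm (T.localization s)

end HilbertField.Adjointable

/-! ### Representations -/

section Representations

variable {X : Type u} [Groupoid.{v} X] [TopologicalSpace X] [TopologicalSpace (Arrows X)]
  {H : X → Type w} [∀ s, NormedAddCommGroup (H s)] [∀ s, InnerProductSpace ℂ (H s)]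
  [∀ s, CompleteSpace (H s)]

/-- A continuous unitary representation of a groupoid on the continuous Hilbert bundle `F`. -/
structure UnitaryRep (F : HilbertField X H) where
  /-- the unitary operator attached to an arrow -/
  toFun : ∀ {s t : X}, (s ⟶ t) → (H s ≃ₗᵢ[ℂ] H t)
  map_id : ∀ s : X, toFun (𝟙 s) = LinearIsometryEquiv.refl ℂ (H s)
  map_comp : ∀ {r s t : X} (y : r ⟶ s) (x : s ⟶ t), toFun (y ≫ x) = (toFun y).trans (toFun x)
  map_inv : ∀ {s t : X} (x : s ⟶ t), toFun (Groupoid.inv x) = (toFun x).symm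
  continuous_coeff : ∀ ξ ∈ F.c0, ∀ η ∈ F.c0,
    Continuous fun x : Arrows X => inner ℂ (η x.rng) (toFun x.hom (ξ x.dom))

namespace UnitaryRep

variable {F : HilbertField X H} (π : UnitaryRep F)

/-- The action `x · A = π(x) A π(x⁻¹)` of an arrow on operators on the fibre over its domain. -/
noncomputable def conj (x : Arrows X) (A : H x.dom →L[ℂ] H x.dom) : H x.rng →L[ℂ] H x.rng :=
  (π.toFun x.hom : H x.dom →L[ℂ] H x.rng) ∘L A ∘L
    (π.toFun (Groupoid.inv x.hom) : H x.rng →L[ℂ] H x.dom)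

/-- `π` is amenable: there is a net of Hilbert–Schmidt operators `T i` on `C₀(X, H)` with
`‖T i‖₂ ≤ 1` such that `‖(T i)_s‖₂ → 1` uniformly on compact subsets of the unit space and
`⟨x · (T i)_{d(x)}, (T i)_{r(x)}⟩ → 1` uniformly on compact subsets of the groupoid. -/
def IsAmenable [T2Space X] [LocallyCompactSpace X] : Prop :=
  ∃ (I : Type (max u v)) (_ : Preorder I) (_ : Nonempty I) (_ : IsDirectedOrder I)
    (T : I → F.Adjointable),
    (∀ i, (T i).IsHilbertSchmidt) ∧
    (∀ i, (T i).hsModuleNorm ≤ 1) ∧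
    (∀ C : Set X, IsCompact C →
      TendstoUniformlyOn (fun i s => (hsNorm ((T i).localization s)).toReal) (fun _ => 1)
        atTop C) ∧
    (∀ C : Set (Arrows X), IsCompact C →
      TendstoUniformlyOn
        (fun i x => hsInner (π.conj x ((T i).localization x.dom)) ((T i).localization x.rng))
        (fun _ => 1) atTop C)

end UnitaryRep

section Subrepresentation

variable {L : ∀ s, Submodule ℂ (H s)} [∀ s, CompleteSpace (L s)]

/-- Sections of a family `L` of subspaces of the fibres, regarded as sections of `H`. -/
def inclusion (L : ∀ s, Submodule ℂ (H s)) : (∀ s, L s) →ₗ[ℂ] (∀ s, H s) where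
  toFun ξ s := ξ s
  map_add' _ _ := rfl
  map_smul' _ _ := rfl

/-- `ρ` is a subrepresentation of `π`: its bundle is a subbundle of that of `π` (the fibres of `ρ`
are closed subspaces of those of `π`, and the continuous sections of `ρ` are continuous sections for
`π`), and `ρ(x)` is the restriction of `π(x)` for each arrow `x`. -/
structure IsSubrepresentation {F' : HilbertField X fun s => L s} {F : HilbertField X H}
    (ρ : UnitaryRep F') (π : UnitaryRep F) : Prop where
  sections_le : F'.sections.map (inclusion L) ≤ F.sections
  map_eq : ∀ {s t : X} (x : s ⟶ t) (h : L s), (ρ.toFun x h : H t) = π.toFun x (h : H s)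

end Subrepresentation

end Representations

end GroupoidRep

/-! Amenability passes from `ρ` to `π` by extending each operator `T` of the net by zero on the
orthogonal complement. Because the submodule is complemented, the fibrewise orthogonal projections
assemble to a map `P` from sections of `π` to sections of `ρ` vanishing at infinity. It is adjoint
to the inclusion `J`, so `J T P` is adjointable (`exists_adjointable_extension`).

Over `s` the extension is `W A W*`, where `A` is the fibre of `T` and `W` is the inclusion of `L s`
into `H s`. For any isometry `W`, the map `A ↦ W A W*` preserves Hilbert–Schmidt norms
(`traceSq_dilate`) and, for operators of finite norm, inner products (`hsInner_dilate`). Conjugation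
by `π(x)` is another such map, and the extension intertwines the conjugations by `ρ(x)` and `π(x)`
since `π(x)` restricts to `ρ(x)`. Every quantity in the definition of amenability is therefore
unchanged, and the extended net has the same limits. -/

namespace GroupoidRep

open CategoryTheory Filter Topology
open scoped ENNReal NNReal InnerProduct

attribute [-instance] WithCStarModule.instCStarModuleComplex

/-! ### Basis independence of Hilbert–Schmidt norms and inner products -/

section HilbertSchmidt

variable {K : Type*} [NormedAddCommGroup K] [InnerProductSpace ℂ K] [CompleteSpace K]
  {K' : Type*} [NormedAddCommGroup K'] [InnerProductSpace ℂ K'] [CompleteSpace K']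
  {K'' : Type*} [NormedAddCommGroup K''] [InnerProductSpace ℂ K''] [CompleteSpace K'']

/-- Parseval's identity in `ℝ≥0∞`. -/
theorem tsum_enorm_inner_sq {ι : Type*} (b : HilbertBasis ι ℂ K) (x : K) :
    ∑' i, ‖inner ℂ (b i) x‖ₑ ^ 2 = ‖x‖ₑ ^ 2 := by
  have h : HasSum (fun i => ‖inner ℂ (b i) x‖ ^ 2) (‖x‖ ^ 2) := by
    refine Complex.hasSum_ofReal.1 ?_
    have hx : ((‖x‖ ^ 2 : ℝ) : ℂ) = inner ℂ x x := by
      rw [inner_self_eq_norm_sq_to_K]; simp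
    rw [hx]
    refine (b.hasSum_inner_mul_inner x x).congr_fun fun i => ?_
    rw [← inner_conj_symm x (b i), ← Complex.normSq_eq_conj_mul_self, Complex.normSq_eq_norm_sq]
  rw [← ofReal_norm, ← ENNReal.ofReal_pow (norm_nonneg x), ← h.tsum_eq,
    ENNReal.ofReal_tsum_of_nonneg (fun i => by positivity) h.summable]
  exact tsum_congr fun i => by rw [← ofReal_norm, ENNReal.ofReal_pow (norm_nonneg _)]

/-- A bounded operator and its adjoint have the same Hilbert–Schmidt norm, whatever the
orthonormal bases in which these are computed. -/
theorem tsum_enorm_sq_adjoint {ι κ : Type*} (b : HilbertBasis ι ℂ K) (c : HilbertBasis κ ℂ K')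
    (A : K →L[ℂ] K') : ∑' i, ‖A (b i)‖ₑ ^ 2 = ∑' j, ‖(A†) (c j)‖ₑ ^ 2 := by
  -- By Parseval both sides become double sums of squared matrix coefficients; nonnegativity permits
  -- the interchange without any finiteness assumption.
  simp_rw [← tsum_enorm_inner_sq c, ← tsum_enorm_inner_sq b]
  rw [ENNReal.tsum_comm]
  refine tsum_congr fun j => tsum_congr fun i => ?_
  rw [ContinuousLinearMap.adjoint_inner_right, ← inner_conj_symm, RCLike.enorm_conj]

/-- The operator `W A W*` on `K'` obtained from an operator `A` on `K` and an isometric embedding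
`W` of `K` into `K'`. -/
noncomputable def dilate (W : K →ₗᵢ[ℂ] K') (A : K →L[ℂ] K) : K' →L[ℂ] K' :=
  W.toContinuousLinearMap ∘L A ∘L W.toContinuousLinearMap†

/-- Functoriality turns an identity between isometries into one between the operators they
transport. -/
theorem dilate_comp (V : K' →ₗᵢ[ℂ] K'') (W : K →ₗᵢ[ℂ] K') (A : K →L[ℂ] K) :
    dilate (V.comp W) A = dilate V (dilate W A) := by
  have h : (V.comp W).toContinuousLinearMap =
      V.toContinuousLinearMap ∘L W.toContinuousLinearMap := rfl
  simp only [dilate, h, ContinuousLinearMap.adjoint_comp, ContinuousLinearMap.comp_assoc]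

theorem dilate_add (W : K →ₗᵢ[ℂ] K') (A B : K →L[ℂ] K) :
    dilate W (A + B) = dilate W A + dilate W B := by
  ext; simp [dilate]

theorem dilate_smul (W : K →ₗᵢ[ℂ] K') (c : ℂ) (A : K →L[ℂ] K) :
    dilate W (c • A) = c • dilate W A := by
  ext; simp [dilate]

/-- The outer `W` preserves norms. The inner `W*` is removed by passing to the adjoint, where it
becomes an outer `W`; comparing `A` with its adjoint closes the chain. -/
theorem traceSq_dilate (W : K →ₗᵢ[ℂ] K') (A : K →L[ℂ] K) :
    traceSq (dilate W A) = traceSq A := by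
  have h : ∀ x, ‖W.toContinuousLinearMap x‖ₑ = ‖x‖ₑ := fun x => by
    rw [← ofReal_norm, ← ofReal_norm]; exact congrArg ENNReal.ofReal (W.norm_map x)
  unfold traceSq
  simp only [dilate, ContinuousLinearMap.comp_apply, h]
  rw [tsum_enorm_sq_adjoint (basis K) (basis K) A]
  refine (tsum_enorm_sq_adjoint (basis K') (basis K)
    (A ∘L W.toContinuousLinearMap†)).trans ?_
  simp only [ContinuousLinearMap.adjoint_comp, ContinuousLinearMap.adjoint_adjoint,
    ContinuousLinearMap.comp_apply, h]

theorem hsNorm_dilate (W : K →ₗᵢ[ℂ] K') (A : K →L[ℂ] K) : hsNorm (dilate W A) = hsNorm A := by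
  rw [hsNorm, hsNorm, traceSq_dilate]

theorem hasSum_norm_sq_of_traceSq_ne_top {A : K →L[ℂ] K} (hA : traceSq A ≠ ∞) :
    HasSum (fun i => ‖A (basis K i)‖ ^ 2) (traceSq A).toReal := by
  have h : (fun i => ‖A (basis K i)‖ ^ 2) = fun i => (‖A (basis K i)‖ₑ ^ 2).toReal := by
    ext i; simp
  rw [h, traceSq, ENNReal.tsum_toReal_eq (ENNReal.ne_top_of_tsum_ne_top hA)]
  exact ENNReal.hasSum_toReal hA

theorem traceSq_smul_ne_top {A : K →L[ℂ] K} (c : ℂ) (hA : traceSq A ≠ ∞) :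
    traceSq (c • A) ≠ ∞ := by
  have : traceSq (c • A) = ‖c‖ₑ ^ 2 * traceSq A := by
    simp only [traceSq, smul_apply, enorm_smul, mul_pow, ENNReal.tsum_mul_left]
  rw [this]
  exact ENNReal.mul_ne_top (by simp) hA

theorem traceSq_add_ne_top {A B : K →L[ℂ] K} (hA : traceSq A ≠ ∞) (hB : traceSq B ≠ ∞) :
    traceSq (A + B) ≠ ∞ := by
  -- The factor is `2 ^ (p - 1)` at `p = 2`, from convexity of the square.
  have hle : traceSq (A + B) ≤ 2 * (traceSq A + traceSq B) := by
    simp only [traceSq]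
    rw [← ENNReal.tsum_add, ← ENNReal.tsum_mul_left]
    refine ENNReal.tsum_le_tsum fun i => ?_
    have h := ENNReal.rpow_add_le_mul_rpow_add_rpow ‖A (basis K i)‖ₑ ‖B (basis K i)‖ₑ
      (show (1 : ℝ) ≤ 2 by norm_num)
    norm_num at h
    exact (pow_le_pow_left' (enorm_add_le _ _) 2).trans h
  exact ne_top_of_le_ne_top (ENNReal.mul_ne_top (by simp) (ENNReal.add_ne_top.2 ⟨hA, hB⟩)) hle

/-- Polarization for Hilbert–Schmidt operators. -/
theorem hsInner_eq_sum_traceSq {A B : K →L[ℂ] K} (hA : traceSq A ≠ ∞) (hB : traceSq B ≠ ∞) :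
    hsInner A B =
      (((traceSq (B + A)).toReal : ℂ) - (traceSq (B + (-1 : ℂ) • A)).toReal +
        ((traceSq (B + (-Complex.I) • A)).toReal - (traceSq (B + Complex.I • A)).toReal) *
          Complex.I) / 4 := by
  -- One summability statement serves all four terms `B + c A` with `c = ±1, ±i`; `B` stands first
  -- because it fills the conjugate-linear slot of the inner product.
  have h (c : ℂ) := Complex.hasSum_ofReal.2 <| hasSum_norm_sq_of_traceSq_ne_top
    (traceSq_add_ne_top hB (traceSq_smul_ne_top c hA))
  have h1 := h 1
  rw [one_smul] at h1
  refine HasSum.tsum_eq ?_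
  refine (((h1.sub (h (-1))).add
    (((h (-Complex.I)).sub (h Complex.I)).mul_right Complex.I)).div_const 4).congr_fun fun i => ?_
  rw [inner_eq_sum_norm_sq_div_four]
  simp [← sub_eq_add_neg]

/-- Polarization reduces this to the invariance of `traceSq`, as dilation is linear in the operator.
Finiteness of the traces makes the polarized series converge. -/
theorem hsInner_dilate (W : K →ₗᵢ[ℂ] K') {A B : K →L[ℂ] K} (hA : traceSq A ≠ ∞)
    (hB : traceSq B ≠ ∞) : hsInner (dilate W A) (dilate W B) = hsInner A B := by
  rw [hsInner_eq_sum_traceSq hA hB, hsInner_eq_sum_traceSq (by rwa [traceSq_dilate])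
    (by rwa [traceSq_dilate])]
  simp only [← dilate_add, ← dilate_smul, traceSq_dilate]

end HilbertSchmidt

/-! ### Extension of operators from a complemented submodule -/

namespace HilbertField

variable {X : Type u} [TopologicalSpace X] {H : X → Type w}
  [∀ s, NormedAddCommGroup (H s)] [∀ s, InnerProductSpace ℂ (H s)] [∀ s, CompleteSpace (H s)]
  {L : ∀ s, Submodule ℂ (H s)} [∀ s, CompleteSpace (L s)]
  {F : HilbertField X H} {F' : HilbertField X fun s => L s}

variable [T2Space X] [LocallyCompactSpace X]

/-- Every vector of the fibre is the value of a section, so the values on sections determine the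
operator. -/
theorem Adjointable.localization_eq (T : F.Adjointable) {s : X} {A : H s →L[ℂ] H s}
    (hA : ∀ ξ : F.c0, A (ξ.1 s) = (T.toFun ξ).1 s) : T.localization s = A := by
  ext h
  obtain ⟨ξ, rfl⟩ := exists_c0_eq (F := F) s h
  rw [T.localization_apply, hA]

/-- The projection onto a complemented submodule is the fibrewise orthogonal projection. -/
theorem exists_c0_projection (hF : F.IsComplemented (F'.c0.map (inclusion L))) (ξ : F.c0) :
    ∃ η : F'.c0, ∀ s, η.1 s = (L s).orthogonalProjectionOnto (ξ.1 s) := by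
  have hξ : ξ.1 ∈ F'.c0.map (inclusion L) ⊔ F.orthogonal (F'.c0.map (inclusion L)) := by
    rw [hF.2]; exact ξ.2
  obtain ⟨_, ⟨a, ha, rfl⟩, b, hb, hab⟩ := Submodule.mem_sup.1 hξ
  refine ⟨⟨a, ha⟩, fun s => ?_⟩
  refine Subtype.ext (Submodule.eq_starProjection_of_mem_orthogonal' (a s).2
    ((Submodule.mem_orthogonal _ _).2 fun l hl => ?_) (congrFun hab s).symm).symm
  -- Orthogonality in the module only tests against sections; since they attain every `l` in `L s`,
  -- it yields orthogonality to the whole fibre.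
  obtain ⟨ζ, hζ⟩ := exists_c0_eq (F := F') s ⟨l, hl⟩
  have := hb.2 _ ⟨ζ.1, ζ.2, rfl⟩ s
  change inner ℂ (ζ.1 s : H s) (b s) = 0 at this
  rwa [hζ] at this

/-- An adjointable operator on a complemented submodule, extended by zero to the orthogonal
complement. -/
theorem exists_adjointable_extension (hF : F.IsComplemented (F'.c0.map (inclusion L)))
    (T : F'.Adjointable) :
    ∃ T' : F.Adjointable, ∀ s,
      T'.localization s = dilate (L s).subtypeₗᵢ (T.localization s) := by
  choose P hP using exists_c0_projection hF
  obtain ⟨S, hS⟩ := T.exists_adjoint_apply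
  let J : F'.c0 → F.c0 := fun η => ⟨inclusion L η.1, hF.1 ⟨η.1, η.2, rfl⟩⟩
  -- `J` and `P` are mutually adjoint, so `J S P` is an adjoint of `J T P` when `S` is one of `T`.
  have hJ : ∀ (η : F'.c0) (ξ : F.c0) s,
      inner ℂ (ξ.1 s) ((J η).1 s) = inner ℂ ((P ξ).1 s) (η.1 s) := fun η ξ s => by
    rw [hP, Submodule.inner_orthogonalProjectionOnto_eq_of_mem_right]; rfl
  let T' : F.Adjointable :=
    { toFun := fun ξ => J (T.toFun (P ξ))
      exists_adjoint := ⟨fun η => J (S (P η)), fun ξ η => by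
        ext s
        rw [c0Inner_apply, c0Inner_apply, hJ, hS, ← inner_conj_symm, ← hJ, inner_conj_symm]⟩ }
  refine ⟨T', fun s => T'.localization_eq fun ξ => ?_⟩
  have hadj : (L s).subtypeₗᵢ.toContinuousLinearMap† = (L s).orthogonalProjectionOnto :=
    (L s).adjoint_subtypeL
  rw [dilate, hadj, ContinuousLinearMap.comp_apply, ContinuousLinearMap.comp_apply, ← hP,
    T.localization_apply]
  rfl

end HilbertField

/-! ### Subrepresentations -/

section Representations

variable {X : Type u} [Groupoid.{v} X] [TopologicalSpace X] [TopologicalSpace (Arrows X)]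
  {H : X → Type w} [∀ s, NormedAddCommGroup (H s)] [∀ s, InnerProductSpace ℂ (H s)]
  [∀ s, CompleteSpace (H s)] {F : HilbertField X H}

/-- Unitarity gives `π(x⁻¹) = π(x)*`, so the invariance results for dilations also cover
conjugation. -/
theorem UnitaryRep.conj_eq_dilate (π : UnitaryRep F) (x : Arrows X)
    (A : H x.dom →L[ℂ] H x.dom) :
    π.conj x A = dilate (π.toFun x.hom).toLinearIsometry A := by
  have h : (π.toFun x.hom).toLinearIsometry.toContinuousLinearMap† =
      (π.toFun (Groupoid.inv x.hom) : H x.rng →L[ℂ] H x.dom) := by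
    rw [π.map_inv]
    exact LinearIsometryEquiv.adjoint_eq_symm _
  rw [dilate, h]
  rfl

/-- Both sides are dilations of `A` along a composite isometry, and the two composites agree because
`π(x)` restricts to `ρ(x)`. -/
theorem IsSubrepresentation.conj_dilate {L : ∀ s, Submodule ℂ (H s)} [∀ s, CompleteSpace (L s)]
    {F' : HilbertField X fun s => L s} {ρ : UnitaryRep F'} {π : UnitaryRep F}
    (h : IsSubrepresentation ρ π) (x : Arrows X) (A : L x.dom →L[ℂ] L x.dom) :
    π.conj x (dilate (L x.dom).subtypeₗᵢ A) = dilate (L x.rng).subtypeₗᵢ (ρ.conj x A) := by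
  rw [π.conj_eq_dilate, ρ.conj_eq_dilate, ← dilate_comp, ← dilate_comp]
  congr 1
  ext l
  exact (h.map_eq x.hom l).symm

end Representations

end GroupoidRep

theorem proposition3p8 {X : Type u} [CategoryTheory.Groupoid.{v} X]
    [TopologicalSpace X] [TopologicalSpace (GroupoidRep.Arrows X)]
    [GroupoidRep.TopologicalGroupoid X] [T2Space (GroupoidRep.Arrows X)]
    [LocallyCompactSpace (GroupoidRep.Arrows X)]
    [SecondCountableTopology (GroupoidRep.Arrows X)]
    {H : X → Type w} [∀ s, NormedAddCommGroup (H s)] [∀ s, InnerProductSpace ℂ (H s)]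
    [∀ s, CompleteSpace (H s)]
    {L : ∀ s, Submodule ℂ (H s)} [∀ s, CompleteSpace (L s)]
    (F : GroupoidRep.HilbertField X H) (F' : GroupoidRep.HilbertField X (fun s => L s))
    (hF : F.CountablyGenerated)
    (π : GroupoidRep.UnitaryRep F) (ρ : GroupoidRep.UnitaryRep F')
    (hsub : GroupoidRep.IsSubrepresentation ρ π)
    (hcompl : F.IsComplemented (F'.c0.map (GroupoidRep.inclusion L)))
    (hρ : ρ.IsAmenable) :
    π.IsAmenable := by
  obtain ⟨I, hI, hne, hdir, T, hHS, hnorm, hunit, hinv⟩ := hρ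
  choose T' hT' using fun i => GroupoidRep.HilbertField.exists_adjointable_extension hcompl (T i)
  -- Finiteness is what the invariance of `hsInner` requires.
  have hfin : ∀ i s, GroupoidRep.traceSq ((T i).localization s) ≠ ⊤ := fun i s => by
    obtain ⟨f, hf⟩ := hHS i
    rw [hf]
    exact ENNReal.coe_ne_top
  refine ⟨I, hI, hne, hdir, T', fun i => ?_, fun i => ?_, fun C hC => ?_, fun C hC => ?_⟩
  · obtain ⟨f, hf⟩ := hHS i
    exact ⟨f, fun s => by rw [hT', GroupoidRep.traceSq_dilate, hf]⟩
  · simpa only [GroupoidRep.HilbertField.Adjointable.hsModuleNorm, hT',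
      GroupoidRep.hsNorm_dilate] using hnorm i
  · simpa only [hT', GroupoidRep.hsNorm_dilate] using hunit C hC
  -- The coefficients for `T'` and `T` are equal at every arrow, so uniform convergence carries over
  -- directly.
  · refine (hinv C hC).congr (Filter.Eventually.of_forall fun i x _ => ?_)
    simp only [hT', hsub.conj_dilate]
    refine (GroupoidRep.hsInner_dilate _ ?_ (hfin i x.rng)).symm
    rw [ρ.conj_eq_dilate, GroupoidRep.traceSq_dilate]
    exact hfin i x.dom
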